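/- All graphs are finite and simple. A plane graph is a graph embedded in the plane; the size of a face is the length of its boundary (an edge with the same face on both sides is counted twice; if the boundary has several components their lengths are added). A distance-two four-coloring of a cubic graph $G$ is a map $\varphi: V(G)\to\{1,2,3,4\}$ such that, for every vertex $v$, the colors of $v$ and of its three neighbors are all distinct. Fix a proper edge-coloring $\kappa$ of the complete graph on $\{1,2,3,4\}$ with three colors. The derived edge-coloring of $\varphi$ gives each edge $uv$ of $G$ the color $\kappa(\varphi(u)\varphi(v))$. If the faces of a plane graph $G$ are colored with three colors so that the two faces incident with any edge have different colors, then coloring each edge with the color not used on its two incident faces gives an edge-coloring of $G$ with the same three colors; an edge-coloring that arises in this way from some such face-coloring is called a special three-edge-coloring of $G$. **Theorem.** Let $G$ be a bipartite cubic plane graph and let $c$ be any special three-edge-coloring of $G$. Then $c$ is the derived edge-coloring of some distance-two four-coloring of $G$ if and only if the size of every face of $G$ is a multiple of $4$. **Corollary.** Every cubic plane graph (not assumed to be bipartite) in which the size of every face is a multiple of $4$ has a distance-two four-coloring. -/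

import Mathlib

namespace SimpleGraph

/-- A plane embedding of a finite simple graph `G` without isolated vertices, given combinatorially.
A dart is an edge together with a direction.
* `rot` is the rotation system: it permutes the darts leaving each vertex cyclically, in the order
  in which they appear around that vertex.
* Following an edge `u → v` and leaving `v` by the dart that comes after `v → u` in the rotation
  traverses the boundary of the face on a fixed side of `u → v`. The closed walks so obtained are
  the boundary components of the faces.
* `face` says which darts have the same face on that side. In a connected graph the faces are just
  the boundary walks; in a disconnected graph a face may have several boundary components.
* `conn`: one can pass between any two darts by moving inside a face or inside a component of `G`.
* `euler`: Euler's formula `v - e + f = 1 + c`, which holds exactly when every component is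
  embedded with genus zero and the faces and components are arranged in a tree-like way, as they
  are in the plane (the unbounded face plays no special role). -/
structure PlaneEmbedding {V : Type*} (G : SimpleGraph V) where
  rot : Equiv.Perm G.Dart
  rot_fst : ∀ d, (rot d).fst = d.fst
  rot_sameCycle : ∀ d e : G.Dart, d.fst = e.fst → rot.SameCycle d e
  face : Setoid G.Dart
  face_next : ∀ d, face d (rot d.symm)
  conn : face ⊔ G.reachableSetoid.comap (fun d : G.Dart => d.fst) = ⊤
  euler : Nat.card V + Nat.card (Quotient face) =
    Nat.card G.edgeSet + 1 + Nat.card G.ConnectedComponent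

namespace PlaneEmbedding

variable {V : Type*} {G : SimpleGraph V} (P : PlaneEmbedding G)

/-- The faces of a plane embedding. -/
abbrev Face : Type _ := Quotient P.face

/-- The face on the chosen side of a dart; the face on the other side of the same edge
is `P.faceOf d.symm`. -/
def faceOf (d : G.Dart) : P.Face := Quotient.mk P.face d

/-- The size of a face: the length of its boundary, an edge with the face on both of its sides
being counted twice. -/
noncomputable def faceSize (f : P.Face) : ℕ := Nat.card {d : G.Dart // P.faceOf d = f}

/-- A proper colouring of the faces with three colours: the two faces incident with an edge have
different colours. -/
def IsFaceColoring (χ : P.Face → Fin 3) : Prop :=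
  ∀ d : G.Dart, χ (P.faceOf d) ≠ χ (P.faceOf d.symm)

/-- An edge-colouring is special if it is induced by some proper face-colouring with three colours:
each edge has the colour not used on its two incident faces. -/
def IsSpecial (c : G.EdgeLabeling (Fin 3)) : Prop :=
  ∃ χ : P.Face → Fin 3, P.IsFaceColoring χ ∧
    ∀ d : G.Dart, c ⟨d.edge, d.edge_mem⟩ ≠ χ (P.faceOf d) ∧
      c ⟨d.edge, d.edge_mem⟩ ≠ χ (P.faceOf d.symm)

end PlaneEmbedding

/-- A distance-two `r`-colouring: at every vertex `v`, the colours of `v` and of all the neighbours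
of `v` are all distinct. -/
def IsDistanceTwoColoring {V : Type*} (G : SimpleGraph V) {r : ℕ} (φ : V → Fin r) : Prop :=
  ∀ v, Set.InjOn φ (insert v (G.neighborSet v))

theorem IsDistanceTwoColoring.ne {V : Type*} {G : SimpleGraph V} {r : ℕ} {φ : V → Fin r}
    (hφ : G.IsDistanceTwoColoring φ) {u v : V} (h : G.Adj u v) : φ u ≠ φ v := fun e =>
  h.ne (hφ u (Set.mem_insert _ _) (Set.mem_insert_of_mem _ h) e)

/-- A distance-two four-colouring of `G`, as a homomorphism to the complete graph on the
four colours. -/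
def IsDistanceTwoColoring.toHom {V : Type*} {G : SimpleGraph V} {φ : V → Fin 4}
    (hφ : G.IsDistanceTwoColoring φ) : G →g (⊤ : SimpleGraph (Fin 4)) where
  toFun := φ
  map_rel' h := (top_adj _ _).2 (hφ.ne h)

/-- The derived edge-colouring of a distance-two four-colouring, with respect to a fixed proper
edge-colouring `κ` of the complete graph on the four colours with three colours: an edge whose ends
have the colours `a` and `b` gets the colour that `κ` gives to `ab`. -/
def derivedEdgeColoring {V : Type*} {G : SimpleGraph V}
    (κ : (⊤ : SimpleGraph (Fin 4)).lineGraph.Coloring (Fin 3)) {φ : V → Fin 4}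
    (hφ : G.IsDistanceTwoColoring φ) : G.EdgeLabeling (Fin 3) :=
  fun e => κ (hφ.toHom.mapEdgeSet e)

end SimpleGraph

/-! Identify the four vertex colours with the Klein group so that `κ` of an edge is the sum of its
ends, the three edge colours being the nonzero elements. A special edge-colouring is then derived
exactly when it is a coboundary; in the plane this means that its sum around every face vanishes.
Around a face of colour `k` the other two colours alternate, so a face of size `2m` has sum `m • k`,
which is zero exactly when `m` is even.

That zero face sums suffice is a dimension count from Euler's formula (`exists_labelCoboundary_eq`),
which also gives the dual statement with vertices and faces exchanged. For the corollary, even faces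
yield a mod 2 potential, i.e. a bipartition; signing darts by it gives a mod 3 flow, whose dual
potential is a proper face-colouring with three colours. -/

namespace SimpleGraph

/-! ### Exactness by counting dimensions -/

section Dart

variable {V : Type*} {G : SimpleGraph V} (K : Type*) [Field K]

/-- Antisymmetric functions on the darts of a graph. -/
def dartCochain (G : SimpleGraph V) : Submodule K (G.Dart → K) where
  carrier := {w | ∀ d, w d.symm = -w d}
  add_mem' ha hb d := by simp [ha d, hb d, add_comm]
  zero_mem' d := by simp
  smul_mem' r w hw d := by simp [hw d]

variable {K}

/-- The coboundary of a function of labels of darts: its difference along each edge. -/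
def labelCoboundary {X : Type*} (p : G.Dart → X) : (X → K) →ₗ[K] dartCochain K G where
  toFun φ := ⟨fun d => φ (p d.symm) - φ (p d), fun d => by simp⟩
  map_add' φ ψ := by ext d; simp; ring
  map_smul' r φ := by ext d; simp; ring

@[simp]
theorem labelCoboundary_apply {X : Type*} (p : G.Dart → X) (φ : X → K) (d : G.Dart) :
    (labelCoboundary p φ).1 d = φ (p d.symm) - φ (p d) := rfl

open Classical in
/-- The sums of an antisymmetric function over the darts with each label. -/
noncomputable def labelSum [Fintype G.Dart] {Y : Type*} (q : G.Dart → Y) :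
    dartCochain K G →ₗ[K] (Y → K) where
  toFun w y := ∑ d with q d = y, w.1 d
  map_add' w z := by ext y; simp [Finset.sum_add_distrib]
  map_smul' r w := by ext y; simp [Finset.mul_sum]

open Classical in
theorem labelSum_apply [Fintype G.Dart] {Y : Type*} (q : G.Dart → Y) (w : dartCochain K G)
    (y : Y) : labelSum q w y = ∑ d with q d = y, w.1 d := rfl

instance finite_dart [Finite V] : Finite G.Dart :=
  Finite.of_injective (fun d => d.toProd) (fun _ _ h => Dart.ext _ _ h)

variable (K) in
theorem finrank_dartCochain_le [Finite V] :
    Module.finrank K (dartCochain K G) ≤ Nat.card G.edgeSet := by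
  have := Fintype.ofFinite G.edgeSet
  have hex : ∀ e : G.edgeSet, ∃ d : G.Dart, d.edge = e := by
    rintro ⟨e, he⟩
    induction e with
    | _ u v => exact ⟨⟨(u, v), he⟩, rfl⟩
  choose r hr using hex
  let L : dartCochain K G →ₗ[K] (G.edgeSet → K) :=
    { toFun := fun w e => w.1 (r e)
      map_add' := fun _ _ => rfl
      map_smul' := fun _ _ => rfl }
  have hL : Function.Injective L := by
    intro w z h
    ext d
    have h1 : w.1 (r ⟨d.edge, d.edge_mem⟩) = z.1 (r ⟨d.edge, d.edge_mem⟩) :=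
      congrFun h ⟨d.edge, d.edge_mem⟩
    rcases (dart_edge_eq_iff _ _).1 (hr ⟨d.edge, d.edge_mem⟩) with h2 | h2 <;> rw [h2] at h1
    · exact h1
    · rw [w.2, z.2] at h1
      exact neg_injective h1
  have := LinearMap.finrank_le_finrank_of_injective hL
  rwa [Module.finrank_fintype_fun_eq_card, ← Nat.card_eq_fintype_card] at this

/-- The kernel of the transpose of the label sum consists of label functions without coboundary. -/
theorem finrank_ker_dualMap_labelSum_le [Finite V] [Fintype G.Dart] {Y : Type*} [Fintype Y]
    (q : G.Dart → Y) :
    Module.finrank K (labelSum (K := K) q).dualMap.ker ≤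
      Module.finrank K (labelCoboundary (K := K) q).ker := by
  classical
  let L : Module.Dual K (Y → K) →ₗ[K] (Y → K) :=
    { toFun := fun f y => f (Pi.single y 1)
      map_add' := fun _ _ => rfl
      map_smul' := fun _ _ => rfl }
  have hL : Function.Injective L := by
    intro f g h
    refine LinearMap.pi_ext' fun y => LinearMap.ext_ring ?_
    exact congrFun h y
  have hmem : ∀ f ∈ (labelSum (K := K) q).dualMap.ker,
      L f ∈ (labelCoboundary (K := K) q).ker := by
    intro f hf
    rw [LinearMap.mem_ker] at hf ⊢
    ext d
    -- Testing `f` on the unit flow along one edge reads off the coboundary of `L f` there.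
    let w : dartCochain K G := ⟨Pi.single d.symm 1 - Pi.single d 1, fun e => by
      have h1 : e.symm = d ↔ e = d.symm :=
        ⟨fun h => by rw [← h, Dart.symm_symm], fun h => by rw [h, Dart.symm_symm]⟩
      have h2 : e.symm = d.symm ↔ e = d := Dart.symm_involutive.injective.eq_iff
      simp [Pi.single_apply, h1, h2]⟩
    have hw : labelSum q w = Pi.single (q d.symm) 1 - Pi.single (q d) 1 := by
      ext y
      rw [labelSum_apply]
      simp only [w, Pi.sub_apply, Finset.sum_sub_distrib, Pi.single_apply, Finset.sum_ite_eq',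
        Finset.mem_filter, Finset.mem_univ, true_and]
      simp only [eq_comm]
    have := LinearMap.congr_fun hf w
    rw [LinearMap.dualMap_apply, hw, map_sub] at this
    exact this
  exact LinearMap.finrank_le_finrank_of_injective
    (f := L.restrict hmem) (fun a b h => Subtype.ext (hL (congrArg Subtype.val h)))

/-- Exactness of label coboundary and label sum, by counting dimensions. -/
theorem exists_labelCoboundary_eq [Finite V] [Fintype G.Dart] {X Y : Type*} [Fintype X] [Fintype Y]
    (p : G.Dart → X) (q : G.Dart → Y) (hpq : ∀ φ : X → K, labelSum q (labelCoboundary p φ) = 0)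
    (hcard : Nat.card G.edgeSet + Module.finrank K (labelCoboundary (K := K) p).ker +
      Module.finrank K (labelCoboundary (K := K) q).ker ≤ Nat.card X + Nat.card Y)
    (w : dartCochain K G) (hw : labelSum q w = 0) : ∃ φ : X → K, labelCoboundary p φ = w := by
  have hle : (labelCoboundary (K := K) p).range ≤ (labelSum (K := K) q).ker := by
    rintro _ ⟨φ, rfl⟩
    exact hpq φ
  have h1 := (labelCoboundary (K := K) p).finrank_range_add_finrank_ker
  have h2 := (labelSum (K := K) q).finrank_range_add_finrank_ker
  have h3 := (labelSum (K := K) q).dualMap.finrank_range_add_finrank_ker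
  rw [LinearMap.finrank_range_dualMap_eq_finrank_range, Subspace.dual_finrank_eq,
    Module.finrank_fintype_fun_eq_card, ← Nat.card_eq_fintype_card] at h3
  rw [Module.finrank_fintype_fun_eq_card, ← Nat.card_eq_fintype_card] at h1
  have h4 := finrank_ker_dualMap_labelSum_le (K := K) q
  have h5 := finrank_dartCochain_le K (G := G)
  -- By `hcard`, the kernel of the sum is no larger than the range of the coboundary it contains.
  have heq := Submodule.eq_of_le_of_finrank_le hle (by omega)
  have : w ∈ (labelCoboundary (K := K) p).range := heq ▸ hw
  exact this

theorem finrank_ker_labelCoboundary_fst_le [Finite V] :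
    Module.finrank K (labelCoboundary (K := K) (fun d : G.Dart => d.fst)).ker ≤
      Nat.card G.ConnectedComponent := by
  have := Fintype.ofFinite G.ConnectedComponent
  let L : (labelCoboundary (K := K) (fun d : G.Dart => d.fst)).ker →ₗ[K]
      (G.ConnectedComponent → K) :=
    { toFun := fun φ C => φ.1 C.out
      map_add' := fun _ _ => rfl
      map_smul' := fun _ _ => rfl }
  have hconst : ∀ φ ∈ (labelCoboundary (K := K) (fun d : G.Dart => d.fst)).ker,
      ∀ u v, G.Reachable u v → φ u = φ v := by
    rintro φ hφ u v ⟨p⟩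
    induction p with
    | nil => rfl
    | cons h _ ih =>
      rw [← ih]
      have := congrFun (congrArg Subtype.val hφ) ⟨(_, _), h⟩
      exact (sub_eq_zero.1 this).symm
  have hL : Function.Injective L := by
    intro φ ψ h
    ext v
    have hr : G.Reachable (G.connectedComponentMk v).out v :=
      ConnectedComponent.exact (Quot.out_eq _)
    rw [← hconst φ.1 φ.2 _ _ hr, ← hconst ψ.1 ψ.2 _ _ hr]
    exact congrFun h _
  have := LinearMap.finrank_le_finrank_of_injective hL
  rwa [Module.finrank_fintype_fun_eq_card, ← Nat.card_eq_fintype_card] at this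

end Dart

/-! ### Potentials on the vertices and faces of a plane embedding -/

namespace PlaneEmbedding

variable {V : Type*} {G : SimpleGraph V} (P : PlaneEmbedding G)

/-- The dart following a given one on the boundary of its face. -/
def next : Equiv.Perm G.Dart := Dart.symm_involutive.toPerm.trans P.rot

theorem next_apply (d : G.Dart) : P.next d = P.rot d.symm := rfl

theorem faceOf_rot (d : G.Dart) : P.faceOf (P.rot d) = P.faceOf d.symm := by
  have := P.face_next d.symm
  rw [Dart.symm_symm] at this
  exact (Quotient.sound this).symm

theorem faceOf_next (d : G.Dart) : P.faceOf (P.next d) = P.faceOf d := by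
  rw [next_apply, faceOf_rot, Dart.symm_symm]

theorem next_fst (d : G.Dart) : (P.next d).fst = d.snd := P.rot_fst _

/-- Turning about a vertex crosses one edge at a time, walks reach the rest of the component, and
`conn` links the components through common faces. -/
theorem eq_of_faceOf_symm_eq {α : Type*} (h : P.Face → α)
    (hs : ∀ d : G.Dart, h (P.faceOf d.symm) = h (P.faceOf d)) (d e : G.Dart) :
    h (P.faceOf d) = h (P.faceOf e) := by
  have hrot : ∀ d, h (P.faceOf (P.rot d)) = h (P.faceOf d) := fun d => by rw [faceOf_rot, hs]
  have hsame : ∀ d e : G.Dart, d.fst = e.fst → h (P.faceOf d) = h (P.faceOf e) := by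
    intro d e hde
    obtain ⟨n, rfl⟩ := P.rot_sameCycle d e hde
    induction n with
    | zero => rfl
    | succ n ih =>
      rw [add_comm, zpow_add, zpow_one, Equiv.Perm.mul_apply, hrot]
      exact ih (by rw [hde, add_comm, zpow_add, zpow_one, Equiv.Perm.mul_apply, P.rot_fst])
    | pred n ih =>
      have hx : P.rot ((P.rot ^ (-(n : ℤ) - 1)) d) = (P.rot ^ (-(n : ℤ))) d := by
        rw [← Equiv.Perm.mul_apply, ← zpow_one_add]
        congr 2; ring
      rw [← hrot ((P.rot ^ (-(n : ℤ) - 1)) d), hx]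
      exact ih (by rw [hde, ← hx, P.rot_fst])
  have hwalk : ∀ u v, G.Reachable u v → ∀ d e : G.Dart, d.fst = u → e.fst = v →
      h (P.faceOf d) = h (P.faceOf e) := by
    rintro u v ⟨p⟩
    induction p with
    | nil => exact fun d e hd he => hsame d e (hd.trans he.symm)
    | cons hadj _ ih =>
      intro d e hd he
      rw [hsame d ⟨(_, _), hadj⟩ hd, ← hs]
      exact ih _ e rfl he
  have hle : P.face ⊔ G.reachableSetoid.comap (fun d : G.Dart => d.fst) ≤
      Setoid.ker (fun d => h (P.faceOf d)) := by
    refine sup_le ?_ ?_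
    · intro d e hde
      exact congrArg h (Quotient.sound hde)
    · intro d e hde
      exact hwalk _ _ hde d e rfl rfl
  rw [P.conn] at hle
  exact hle (show (⊤ : Setoid G.Dart) d e from trivial)

theorem finrank_ker_labelCoboundary_faceOf_le [Finite V] (K : Type*) [Field K] :
    Module.finrank K (labelCoboundary (K := K) P.faceOf).ker ≤ 1 := by
  have := Fintype.ofFinite P.Face
  have hc : ∀ φ ∈ (labelCoboundary (K := K) P.faceOf).ker, ∀ d e : G.Dart,
      φ (P.faceOf d) = φ (P.faceOf e) := fun φ hφ => P.eq_of_faceOf_symm_eq φ fun d =>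
    sub_eq_zero.1 (congrFun (congrArg Subtype.val hφ) d)
  rcases isEmpty_or_nonempty G.Dart with hD | ⟨⟨d⟩⟩
  · have : IsEmpty P.Face := Quotient.instIsEmpty
    have h1 := Submodule.finrank_le (labelCoboundary (K := K) P.faceOf).ker
    rw [Module.finrank_fintype_fun_eq_card, Fintype.card_eq_zero] at h1
    exact h1.trans zero_le_one
  · let L : (labelCoboundary (K := K) P.faceOf).ker →ₗ[K] K :=
      { toFun := fun φ => φ.1 (P.faceOf d)
        map_add' := fun _ _ => rfl
        map_smul' := fun _ _ => rfl }
    have hL : Function.Injective L := by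
      intro φ ψ h
      ext f
      induction f using Quotient.ind with
      | _ e =>
        change φ.1 (P.faceOf e) = ψ.1 (P.faceOf e)
        rw [hc φ.1 φ.2 e d, hc ψ.1 ψ.2 e d]
        exact h
    simpa using LinearMap.finrank_le_finrank_of_injective hL

open Classical in
/-- An antisymmetric function on darts with zero sum over each face is a coboundary. -/
theorem exists_eq_sub_of_faceSum_eq_zero [Finite V] [Fintype G.Dart] {K : Type*} [Field K]
    (w : G.Dart → K) (hw : ∀ d, w d.symm = -w d)
    (hsum : ∀ f : P.Face, ∑ d with P.faceOf d = f, w d = 0) :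
    ∃ φ : V → K, ∀ d : G.Dart, w d = φ d.snd - φ d.fst := by
  have := Fintype.ofFinite P.Face
  have := Fintype.ofFinite V
  obtain ⟨φ, hφ⟩ := exists_labelCoboundary_eq (K := K) (fun d : G.Dart => d.fst) P.faceOf
    (fun φ => by
      ext f
      simp only [labelSum_apply, labelCoboundary_apply, Finset.sum_sub_distrib, Pi.zero_apply]
      rw [sub_eq_zero]
      -- `next` permutes the darts of a face and carries heads to tails, so the sum telescopes.
      refine Finset.sum_equiv P.next (fun d => ?_) (fun d _ => ?_)
      · simp [faceOf_next]
      · rw [next_fst]; rfl)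
    (by
      have h1 := finrank_ker_labelCoboundary_fst_le (K := K) (G := G)
      have h2 := P.finrank_ker_labelCoboundary_faceOf_le K
      have h3 := P.euler
      change _ ≤ _ + Nat.card (Quotient P.face)
      omega)
    ⟨w, hw⟩ (by ext x; rw [labelSum_apply, Pi.zero_apply]; convert hsum x)
  exact ⟨φ, fun d => (congrFun (congrArg Subtype.val hφ) d).symm⟩

open Classical in
/-- An antisymmetric function on darts with zero sum at each vertex is a difference of potentials
of faces. -/
theorem exists_eq_sub_of_vertexSum_eq_zero [Finite V] [Fintype G.Dart] {K : Type*} [Field K]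
    (w : G.Dart → K) (hw : ∀ d, w d.symm = -w d)
    (hsum : ∀ v : V, ∑ d with d.fst = v, w d = 0) :
    ∃ χ : P.Face → K, ∀ d : G.Dart, w d = χ (P.faceOf d.symm) - χ (P.faceOf d) := by
  have := Fintype.ofFinite P.Face
  have := Fintype.ofFinite V
  obtain ⟨φ, hφ⟩ := exists_labelCoboundary_eq (K := K) P.faceOf (fun d : G.Dart => d.fst)
    (fun φ => by
      ext v
      simp only [labelSum_apply, labelCoboundary_apply, Finset.sum_sub_distrib, Pi.zero_apply]
      rw [sub_eq_zero]
      refine Finset.sum_equiv P.rot (fun d => ?_) (fun d _ => ?_)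
      · simp [P.rot_fst]
      · rw [faceOf_rot])
    (by
      have h1 := finrank_ker_labelCoboundary_fst_le (K := K) (G := G)
      have h2 := P.finrank_ker_labelCoboundary_faceOf_le K
      have h3 := P.euler
      change _ ≤ Nat.card (Quotient P.face) + _
      omega)
    ⟨w, hw⟩ (by ext x; rw [labelSum_apply, Pi.zero_apply]; convert hsum x)
  exact ⟨φ, fun d => (congrFun (congrArg Subtype.val hφ) d).symm⟩

open Classical in
theorem faceSize_eq_card_filter [Fintype G.Dart] (f : P.Face) :
    P.faceSize f = (Finset.univ.filter fun d => P.faceOf d = f).card := by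
  rw [faceSize, Nat.card_eq_fintype_card, Fintype.card_subtype]

/-- Each edge can be given a colour different from those of its incident faces. -/
theorem exists_edgeLabeling_ne (χ : P.Face → Fin 3) :
    ∃ c : G.EdgeLabeling (Fin 3), ∀ d : G.Dart, c ⟨d.edge, d.edge_mem⟩ ≠ χ (P.faceOf d) ∧
      c ⟨d.edge, d.edge_mem⟩ ≠ χ (P.faceOf d.symm) := by
  have hthird : ∀ x y : Fin 3, ∃ z, z ≠ x ∧ z ≠ y := by decide
  have hex : ∀ e : G.edgeSet, ∃ z : Fin 3, ∀ d : G.Dart, d.edge = e →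
      z ≠ χ (P.faceOf d) ∧ z ≠ χ (P.faceOf d.symm) := by
    rintro ⟨e, he⟩
    induction e with
    | _ u v =>
      obtain ⟨z, hz⟩ := hthird (χ (P.faceOf ⟨(u, v), he⟩)) (χ (P.faceOf (Dart.symm ⟨(u, v), he⟩)))
      refine ⟨z, fun d hd => ?_⟩
      rcases (dart_edge_eq_iff d ⟨(u, v), he⟩).1 hd with rfl | rfl
      · exact hz
      · rw [Dart.symm_symm]
        exact hz.symm
  choose c hc using hex
  exact ⟨c, fun d => hc _ d rfl⟩

/-! ### Rotation and edge colours at a cubic vertex -/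

section Cubic

variable [Fintype V] [G.LocallyFinite]

open Classical in
theorem card_filter_fst_eq [Fintype G.Dart] (hcubic : G.IsRegularOfDegree 3) (v : V) :
    (Finset.univ.filter fun d : G.Dart => d.fst = v).card = 3 := by
  rw [← hcubic v]
  convert G.dart_fst_fiber_card_eq_degree v

/-- The darts at a vertex form one cycle of `rot`, and there are three of them. -/
theorem rot_rot_rot (hcubic : G.IsRegularOfDegree 3) (d : G.Dart) :
    P.rot (P.rot (P.rot d)) = d := by
  classical
  have := Fintype.ofFinite G.Dart
  have horb : MulAction.orbit (Subgroup.zpowers P.rot) d = {e | e.fst = d.fst} := by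
    ext e
    constructor
    · rintro ⟨⟨_, n, rfl⟩, rfl⟩
      change ((P.rot ^ n) d).fst = d.fst
      induction n with
      | zero => rfl
      | succ n ih => rwa [add_comm, zpow_add, zpow_one, Equiv.Perm.mul_apply, P.rot_fst]
      | pred n ih =>
        have hx : P.rot ((P.rot ^ (-(n : ℤ) - 1)) d) = (P.rot ^ (-(n : ℤ))) d := by
          rw [← Equiv.Perm.mul_apply, ← zpow_one_add]
          congr 2; ring
        rw [← ih, ← hx, P.rot_fst]
    · intro he
      obtain ⟨n, hn⟩ := P.rot_sameCycle d e he.symm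
      exact ⟨⟨_, n, rfl⟩, hn⟩
  have hper := MulAction.minimalPeriod_eq_card (a := P.rot) (b := d)
  rw [← Nat.card_eq_fintype_card, horb, Nat.card_eq_fintype_card] at hper
  have hcard := card_filter_fst_eq hcubic d.fst
  rw [← Fintype.card_subtype] at hcard
  have h3 : Function.minimalPeriod (P.rot • ·) d = 3 := hper.trans (by
    rw [← hcard]; exact Fintype.card_congr (Equiv.refl _))
  have := Function.iterate_minimalPeriod (f := (P.rot • ·)) (x := d)
  rw [h3] at this
  exact this

theorem eq_or_eq_rot_or_rot_eq (hcubic : G.IsRegularOfDegree 3) {d e : G.Dart}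
    (h : d.fst = e.fst) : e = d ∨ e = P.rot d ∨ d = P.rot e := by
  obtain ⟨n, rfl⟩ := P.rot_sameCycle d e h
  clear h
  have h3 := P.rot_rot_rot hcubic
  induction n with
  | zero => exact Or.inl rfl
  | succ n ih =>
    rw [add_comm, zpow_add, zpow_one, Equiv.Perm.mul_apply]
    rcases ih with ih | ih | ih
    · rw [ih]; exact Or.inr (Or.inl rfl)
    · rw [ih]; exact Or.inr (Or.inr (h3 d).symm)
    · exact Or.inl ih.symm
  | pred n ih =>
    have hx : P.rot ((P.rot ^ (-(n : ℤ) - 1)) d) = (P.rot ^ (-(n : ℤ))) d := by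
      rw [← Equiv.Perm.mul_apply, ← zpow_one_add]
      congr 2; ring
    rw [← hx] at ih
    rcases ih with ih | ih | ih
    · exact Or.inr (Or.inr ih.symm)
    · exact Or.inl (P.rot.injective ih)
    · refine Or.inr (Or.inl ?_)
      conv_rhs => rw [ih, h3]

variable {P}

/-- The three faces around a vertex have distinct colours, and each edge there takes the colour of
the face opposite to it. -/
theorem IsFaceColoring.rot_ne (hcubic : G.IsRegularOfDegree 3) {χ : P.Face → Fin 3}
    (hχ : P.IsFaceColoring χ) {c : G.EdgeLabeling (Fin 3)}
    (hc : ∀ d : G.Dart, c ⟨d.edge, d.edge_mem⟩ ≠ χ (P.faceOf d) ∧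
      c ⟨d.edge, d.edge_mem⟩ ≠ χ (P.faceOf d.symm)) (d : G.Dart) :
    c ⟨(P.rot d).edge, (P.rot d).edge_mem⟩ ≠ c ⟨d.edge, d.edge_mem⟩ := by
  have h1 := hc d
  have h2 := hc (P.rot d)
  have h3 := hχ d
  have h4 := hχ (P.rot d)
  have h5 := hχ (P.rot (P.rot d))
  rw [← faceOf_rot] at h1 h2 h3 h4 h5
  rw [P.rot_rot_rot hcubic] at h5
  omega

theorem IsFaceColoring.next_ne (hcubic : G.IsRegularOfDegree 3) {χ : P.Face → Fin 3}
    (hχ : P.IsFaceColoring χ) {c : G.EdgeLabeling (Fin 3)}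
    (hc : ∀ d : G.Dart, c ⟨d.edge, d.edge_mem⟩ ≠ χ (P.faceOf d) ∧
      c ⟨d.edge, d.edge_mem⟩ ≠ χ (P.faceOf d.symm)) (d : G.Dart) :
    c ⟨(P.next d).edge, (P.next d).edge_mem⟩ ≠ c ⟨d.edge, d.edge_mem⟩ := by
  have h := hχ.rot_ne hcubic hc d.symm
  simp only [Dart.edge_symm] at h
  exact h

end Cubic

end PlaneEmbedding

/-! ### Colours as elements of the Klein four-group -/

/-- The nonzero elements of the Klein four-group, indexed by three colours. -/
def kleinOfColor : Fin 3 → ZMod 2 × ZMod 2 := ![(1, 0), (0, 1), (1, 1)]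

theorem kleinOfColor_ne_zero : ∀ a, kleinOfColor a ≠ 0 := by decide

theorem kleinOfColor_injective : Function.Injective kleinOfColor := by decide

theorem kleinOfColor_add {a b c : Fin 3} :
    a ≠ b → c ≠ a → c ≠ b → kleinOfColor a + kleinOfColor b = kleinOfColor c := by
  revert a b c; decide

theorem klein_add_self : ∀ x : ZMod 2 × ZMod 2, x + x = 0 := by decide

/-- The colours of the complete graph on four vertices are identified with the Klein four-group. -/
theorem exists_equiv_klein (κ : (⊤ : SimpleGraph (Fin 4)).lineGraph.Coloring (Fin 3)) :
    ∃ ψ : Fin 4 ≃ ZMod 2 × ZMod 2, ∀ i j (h : s(i, j) ∈ (⊤ : SimpleGraph (Fin 4)).edgeSet),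
      kleinOfColor (κ ⟨s(i, j), h⟩) = ψ i + ψ j := by
  have hmem : ∀ {i j : Fin 4}, i ≠ j → s(i, j) ∈ (⊤ : SimpleGraph (Fin 4)).edgeSet :=
    fun h => h
  have hne : ∀ {i j k : Fin 4} (hij : i ≠ j) (hik : i ≠ k), j ≠ k →
      κ ⟨s(i, j), hmem hij⟩ ≠ κ ⟨s(i, k), hmem hik⟩ := by
    intro i j k hij hik hjk
    refine κ.valid ?_
    rw [lineGraph_adj_iff_exists]
    refine ⟨?_, i, by simp, by simp⟩
    intro h
    have := congrArg Subtype.val h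
    simp only [Sym2.congr_right] at this
    exact hjk this
  -- Colour `0` is the origin. In a triangle `0, i, j` the edge `ij` has the third colour, which is
  -- the sum of the other two.
  let ψ : Fin 4 → ZMod 2 × ZMod 2 := fun i =>
    if h : 0 = i then 0 else kleinOfColor (κ ⟨s(0, i), hmem h⟩)
  have hψ0 : ψ 0 = 0 := dif_pos rfl
  have hψ : ∀ {i} (h : 0 ≠ i), ψ i = kleinOfColor (κ ⟨s(0, i), hmem h⟩) := fun h => dif_neg h
  have hsum : ∀ i j (h : s(i, j) ∈ (⊤ : SimpleGraph (Fin 4)).edgeSet),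
      kleinOfColor (κ ⟨s(i, j), h⟩) = ψ i + ψ j := by
    intro i j h
    have hij : i ≠ j := h
    have hswap : ∀ {a b : Fin 4} (hab : a ≠ b),
        κ ⟨s(a, b), hmem hab⟩ = κ ⟨s(b, a), hmem hab.symm⟩ := fun hab => by
      congr 1; exact Subtype.ext Sym2.eq_swap
    by_cases hi : 0 = i
    · subst hi
      rw [hψ0, zero_add, hψ hij]
    by_cases hj : 0 = j
    · subst hj
      rw [hψ0, add_zero, hψ hi, hswap hi]
    rw [hψ hi, hψ hj]
    refine (kleinOfColor_add (hne hi hj hij) ?_ ?_).symm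
    · rw [hswap hi]
      exact hne hij (Ne.symm hi) (Ne.symm hj)
    · rw [hswap hj, hswap hij]
      exact hne hij.symm (Ne.symm hj) (Ne.symm hi)
  have hinj : Function.Injective ψ := by
    intro i j h
    by_contra hij
    have := hsum i j (hmem hij)
    rw [h, klein_add_self] at this
    exact kleinOfColor_ne_zero _ this
  exact ⟨Equiv.ofBijective ψ ((Fintype.bijective_iff_injective_and_card ψ).2 ⟨hinj, rfl⟩), hsum⟩

/-! ### Face sums of special edge-colourings and the main equivalence -/

namespace PlaneEmbedding

variable {V : Type*} {G : SimpleGraph V} {P : PlaneEmbedding G} [Fintype V] [G.LocallyFinite]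

open Classical in
/-- Around a face, the two colours of a special edge-colouring alternate. -/
theorem IsFaceColoring.exists_faceSize_eq [Fintype G.Dart] (hcubic : G.IsRegularOfDegree 3)
    {χ : P.Face → Fin 3} (hχ : P.IsFaceColoring χ) {c : G.EdgeLabeling (Fin 3)}
    (hc : ∀ d : G.Dart, c ⟨d.edge, d.edge_mem⟩ ≠ χ (P.faceOf d) ∧
      c ⟨d.edge, d.edge_mem⟩ ≠ χ (P.faceOf d.symm)) (f : P.Face) :
    ∃ m : ℕ, P.faceSize f = 2 * m ∧
      ∑ d with P.faceOf d = f, kleinOfColor (c ⟨d.edge, d.edge_mem⟩) =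
        m • kleinOfColor (χ f) := by
  set S := Finset.univ.filter fun d => P.faceOf d = f with hS
  set C : G.Dart → Fin 3 := fun d => c ⟨d.edge, d.edge_mem⟩ with hC
  have hmemS : ∀ d, d ∈ S ↔ P.faceOf d = f := fun d => by simp [hS]
  have hCk : ∀ d ∈ S, C d ≠ χ f := fun d hd => by
    have := (hc d).1
    rwa [(hmemS d).1 hd] at this
  have hthree : ∀ k x y : Fin 3, x ≠ k → y ≠ k → y ≠ x → (x = k + 1 ↔ ¬ y = k + 1) := by decide
  -- Only `χ f + 1` and `χ f + 2` occur on the face, and `next` exchanges the two classes of darts.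
  have hcard : (S.filter fun d => C d = χ f + 1).card =
      (S.filter fun d => ¬ C d = χ f + 1).card := by
    refine Finset.card_equiv P.next fun d => ?_
    simp only [Finset.mem_filter, hmemS, faceOf_next]
    refine and_congr_right fun hd => ?_
    refine hthree _ _ _ (hCk d ((hmemS d).2 hd)) (hCk _ ((hmemS _).2 ?_)) (hχ.next_ne hcubic hc d)
    rw [faceOf_next, hd]
  have htot := Finset.card_filter_add_card_filter_not (s := S) (fun d => C d = χ f + 1)
  refine ⟨(S.filter fun d => C d = χ f + 1).card, ?_, ?_⟩
  · rw [faceSize_eq_card_filter, ← hS]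
    omega
  · rw [← Finset.sum_filter_add_sum_filter_not S (fun d => C d = χ f + 1),
      Finset.sum_congr rfl (g := fun _ => kleinOfColor (χ f + 1)),
      Finset.sum_congr (s₁ := S.filter fun d => ¬ C d = χ f + 1) rfl
        (g := fun _ => kleinOfColor (χ f + 2)),
      Finset.sum_const, Finset.sum_const, ← hcard, ← smul_add]
    · congr 1
      generalize χ f = k
      revert k; decide
    · intro d hd
      rw [Finset.mem_filter] at hd
      have h2 : ∀ k x : Fin 3, x ≠ k → ¬ x = k + 1 → x = k + 2 := by decide
      exact congrArg kleinOfColor (h2 _ _ (hCk d hd.1) hd.2)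
    · intro d hd
      exact congrArg kleinOfColor (Finset.mem_filter.1 hd).2

/-- The group has exponent two, so only the parity of `m` matters; `2 * m` will be the face size. -/
theorem nsmul_kleinOfColor_eq_zero_iff (m : ℕ) (k : Fin 3) :
    m • kleinOfColor k = 0 ↔ 4 ∣ 2 * m := by
  have h2 : ∀ k, (2 : ℕ) • kleinOfColor k = 0 := by decide
  obtain ⟨n, rfl | rfl⟩ := Nat.even_or_odd' m
  · rw [mul_comm 2 n, mul_nsmul', h2, nsmul_zero]
    simp only [true_iff]
    omega
  · rw [add_nsmul, mul_comm 2 n, mul_nsmul', h2, nsmul_zero, zero_add, one_nsmul]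
    simp only [kleinOfColor_ne_zero, false_iff]
    omega

/-- If all face sizes are multiples of four, then a special edge-colouring is a coboundary in the
Klein four-group. -/
theorem exists_klein_potential (hcubic : G.IsRegularOfDegree 3)
    {χ : P.Face → Fin 3} (hχ : P.IsFaceColoring χ) {c : G.EdgeLabeling (Fin 3)}
    (hc : ∀ d : G.Dart, c ⟨d.edge, d.edge_mem⟩ ≠ χ (P.faceOf d) ∧
      c ⟨d.edge, d.edge_mem⟩ ≠ χ (P.faceOf d.symm)) (h4 : ∀ f : P.Face, 4 ∣ P.faceSize f) :
    ∃ φ : V → ZMod 2 × ZMod 2, ∀ d : G.Dart,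
      kleinOfColor (c ⟨d.edge, d.edge_mem⟩) = φ d.fst + φ d.snd := by
  classical
  have := Fintype.ofFinite G.Dart
  have hsum : ∀ f : P.Face,
      ∑ d with P.faceOf d = f, kleinOfColor (c ⟨d.edge, d.edge_mem⟩) = 0 := by
    intro f
    obtain ⟨m, hm, hs⟩ := hχ.exists_faceSize_eq hcubic hc f
    rw [hs, nsmul_kleinOfColor_eq_zero_iff, ← hm]
    exact h4 f
  have hneg : ∀ x : ZMod 2, x = -x := by decide
  -- Exactness holds over a field, so it is applied to each `ZMod 2` coordinate.
  obtain ⟨φ₁, h₁⟩ := P.exists_eq_sub_of_faceSum_eq_zero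
    (fun d => (kleinOfColor (c ⟨d.edge, d.edge_mem⟩)).1)
    (fun d => by simp only [Dart.edge_symm]; exact hneg _)
    (fun f => by rw [← Prod.fst_sum, hsum f]; rfl)
  obtain ⟨φ₂, h₂⟩ := P.exists_eq_sub_of_faceSum_eq_zero
    (fun d => (kleinOfColor (c ⟨d.edge, d.edge_mem⟩)).2)
    (fun d => by simp only [Dart.edge_symm]; exact hneg _)
    (fun f => by rw [← Prod.snd_sum, hsum f]; rfl)
  have hsub : ∀ x y : ZMod 2, y - x = x + y := by decide
  refine ⟨fun v => (φ₁ v, φ₂ v), fun d => Prod.ext ?_ ?_⟩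
  · exact (h₁ d).trans (hsub _ _)
  · exact (h₂ d).trans (hsub _ _)

/-- Edge values are nonzero, so adjacent vertices differ; two neighbours of `v` with equal values
would give two edges at `v` of the same colour. -/
theorem isDistanceTwoColoring_of_klein_potential (hcubic : G.IsRegularOfDegree 3)
    {χ : P.Face → Fin 3} (hχ : P.IsFaceColoring χ) {c : G.EdgeLabeling (Fin 3)}
    (hc : ∀ d : G.Dart, c ⟨d.edge, d.edge_mem⟩ ≠ χ (P.faceOf d) ∧
      c ⟨d.edge, d.edge_mem⟩ ≠ χ (P.faceOf d.symm)) {φ : V → ZMod 2 × ZMod 2}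
    (hφ : ∀ d : G.Dart, kleinOfColor (c ⟨d.edge, d.edge_mem⟩) = φ d.fst + φ d.snd)
    (ψ : Fin 4 ≃ ZMod 2 × ZMod 2) : G.IsDistanceTwoColoring (fun v => ψ.symm (φ v)) := by
  have hadj : ∀ {u v}, G.Adj u v → φ u ≠ φ v := by
    intro u v h huv
    have := hφ ⟨(u, v), h⟩
    rw [huv, klein_add_self] at this
    exact kleinOfColor_ne_zero _ this
  have hnbr : ∀ {v a b}, G.Adj v a → G.Adj v b → φ a = φ b → a = b := by
    intro v a b ha hb hab
    by_contra hne
    have hcol : c ⟨(⟨(v, a), ha⟩ : G.Dart).edge, Dart.edge_mem _⟩ =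
        c ⟨(⟨(v, b), hb⟩ : G.Dart).edge, Dart.edge_mem _⟩ := by
      refine kleinOfColor_injective ?_
      rw [hφ, hφ, hab]
    rcases P.eq_or_eq_rot_or_rot_eq hcubic (d := ⟨(v, a), ha⟩) (e := ⟨(v, b), hb⟩) rfl
      with h | h | h
    · exact hne (congrArg (fun d : G.Dart => d.snd) h).symm
    · rw [h] at hcol
      exact hχ.rot_ne hcubic hc _ hcol.symm
    · rw [h] at hcol
      exact hχ.rot_ne hcubic hc _ hcol
  intro v a ha b hb hab
  replace hab := ψ.symm.injective hab
  rcases ha with rfl | ha <;> rcases hb with rfl | hb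
  · rfl
  · exact absurd hab (hadj hb)
  · exact absurd hab.symm (hadj ha)
  · exact hnbr ha hb hab

variable (P) in
/-- A cubic plane graph whose faces are even has a proper face-colouring with three colours. -/
theorem exists_isFaceColoring (hcubic : G.IsRegularOfDegree 3)
    (h2 : ∀ f : P.Face, 2 ∣ P.faceSize f) : ∃ χ : P.Face → Fin 3, P.IsFaceColoring χ := by
  classical
  have := Fintype.ofFinite G.Dart
  obtain ⟨s, hs⟩ := P.exists_eq_sub_of_faceSum_eq_zero (K := ZMod 2) (fun _ => 1)
    (fun d => by decide)
    (fun f => by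
      rw [Finset.sum_const, ← faceSize_eq_card_filter, nsmul_one]
      exact (ZMod.natCast_eq_zero_iff _ _).2 (h2 f))
  let g : ZMod 2 → ZMod 3 := fun x => if x = 0 then 1 else -1
  have hg : ∀ x y : ZMod 2, 1 = y - x → g y = -g x := by decide
  have hg0 : ∀ x, g x ≠ 0 := by decide
  -- Darts leaving `v` all carry the same sign, opposite to that at their other ends; three equal
  -- terms cancel mod 3. The flow never vanishes, so `χ` changes across every edge.
  obtain ⟨χ, hχ⟩ := P.exists_eq_sub_of_vertexSum_eq_zero (K := ZMod 3) (fun d => g (s d.fst))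
    (fun d => hg _ _ (hs d))
    (fun v => by
      rw [Finset.sum_congr rfl (g := fun _ => g (s v)) (fun d hd => by
        rw [(Finset.mem_filter.1 hd).2]), Finset.sum_const, card_filter_fst_eq hcubic]
      generalize g (s v) = x
      revert x; decide)
  refine ⟨χ, fun d h => hg0 (s d.fst) ?_⟩
  rw [hχ d, sub_eq_zero]
  exact h.symm

theorem exists_derivedEdgeColoring_eq_iff (hcubic : G.IsRegularOfDegree 3)
    (κ : (⊤ : SimpleGraph (Fin 4)).lineGraph.Coloring (Fin 3)) {c : G.EdgeLabeling (Fin 3)}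
    (hspecial : P.IsSpecial c) :
    (∃ (φ : V → Fin 4) (hφ : G.IsDistanceTwoColoring φ), derivedEdgeColoring κ hφ = c) ↔
      ∀ f : P.Face, 4 ∣ P.faceSize f := by
  classical
  have := Fintype.ofFinite G.Dart
  obtain ⟨χ, hχ, hc⟩ := hspecial
  obtain ⟨ψ, hψ⟩ := exists_equiv_klein κ
  have hder : ∀ {φ : V → Fin 4} (hφ : G.IsDistanceTwoColoring φ) (d : G.Dart),
      kleinOfColor (derivedEdgeColoring κ hφ ⟨d.edge, d.edge_mem⟩) =
        ψ (φ d.fst) + ψ (φ d.snd) :=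
    fun hφ d => hψ _ _ (hφ.toHom.mapEdgeSet ⟨d.edge, d.edge_mem⟩).2
  constructor
  · rintro ⟨φ, hφ, rfl⟩ f
    obtain ⟨m, hm, hs⟩ := hχ.exists_faceSize_eq hcubic hc f
    rw [hm, ← nsmul_kleinOfColor_eq_zero_iff m (χ f), ← hs]
    simp only [hder hφ, Finset.sum_add_distrib]
    -- Each boundary vertex occurs as often as a head as it does as a tail, so the face sum is twice
    -- something.
    have : ∑ d with P.faceOf d = f, ψ (φ d.snd) = ∑ d with P.faceOf d = f, ψ (φ d.fst) := by
      refine Finset.sum_equiv P.next (fun d => ?_) (fun d _ => ?_)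
      · simp [faceOf_next]
      · rw [next_fst]
    rw [this, klein_add_self]
  · intro h4
    obtain ⟨φ, hφ⟩ := exists_klein_potential hcubic hχ hc h4
    have hcol := isDistanceTwoColoring_of_klein_potential hcubic hχ hc hφ ψ
    refine ⟨_, hcol, ?_⟩
    funext e
    obtain ⟨e, he⟩ := e
    induction e with
    | _ u v =>
      refine kleinOfColor_injective ?_
      have h1 := hder hcol ⟨(u, v), he⟩
      have h2 := hφ ⟨(u, v), he⟩
      simp only [Equiv.apply_symm_apply] at h1
      exact h1.trans h2.symm

end PlaneEmbedding

end SimpleGraph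

theorem theorem2p3 {V : Type*} [Fintype V] (G : SimpleGraph V) [G.LocallyFinite]
    (hcubic : G.IsRegularOfDegree 3) (P : G.PlaneEmbedding) :
    (G.IsBipartite →
      ∀ (κ : (⊤ : SimpleGraph (Fin 4)).lineGraph.Coloring (Fin 3)) (c : G.EdgeLabeling (Fin 3)),
        P.IsSpecial c →
          ((∃ (φ : V → Fin 4) (hφ : G.IsDistanceTwoColoring φ),
              SimpleGraph.derivedEdgeColoring κ hφ = c) ↔
            ∀ f : P.Face, 4 ∣ P.faceSize f)) ∧
    ((∀ f : P.Face, 4 ∣ P.faceSize f) → ∃ φ : V → Fin 4, G.IsDistanceTwoColoring φ) := by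
  refine ⟨fun _ κ c hc => SimpleGraph.PlaneEmbedding.exists_derivedEdgeColoring_eq_iff hcubic κ hc,
    fun h4 => ?_⟩
  obtain ⟨χ, hχ⟩ := P.exists_isFaceColoring hcubic
    fun f => (show 2 ∣ 4 by norm_num).trans (h4 f)
  obtain ⟨c, hc⟩ := P.exists_edgeLabeling_ne χ
  obtain ⟨φ, hφ⟩ := SimpleGraph.PlaneEmbedding.exists_klein_potential hcubic hχ hc h4
  exact ⟨_, SimpleGraph.PlaneEmbedding.isDistanceTwoColoring_of_klein_potential hcubic hχ hc hφ
    (Fintype.equivOfCardEq rfl)⟩
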